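/- **Setting.** Let $G$ be a connected finite graph (in particular, any one-particle irreducible Feynman graph) with vertex set $V$ and edge set $E$; parallel edges and self-loops are allowed. Each edge $e$ has a mass $m_e\in\mathbb R$, and the external momenta are given by a symmetric matrix $\mathcal P\in\mathbb R^{V\times V}$, $\mathcal P^{u,v}=p_u\cdot p_v$, with $\sum_{v}\mathcal P^{u,v}=0$ for all $u\in V$. No sign or definiteness condition is imposed on $\mathcal P$, so the Euclidean, pseudo-Euclidean and Minkowski regimes are all included. The Symanzik polynomials are $$\mathcal U=\sum_{T}\prod_{e\notin T}x_e,\qquad \mathcal F=-\sum_{F}p(F)^2\prod_{e\notin F}x_e+\mathcal U\sum_{e\in E}m_e^2x_e ,$$ where $T$ runs over the spanning trees and $F$ over the spanning two-forests of $G$, and $p(F)^2=\sum_{u,v\in A}\mathcal P^{u,v}$ with $A$ the vertex set of either component of $F$. A vertex $v$ is external if $\mathcal P^{u,v}\neq0$ for some $u$; let $V^{\rm ext}$ be the set of external vertices. The kinematics are *generic* if $$\sum_{u,v\in V'}\mathcal P^{u,v}\neq\sum_{e\in E'}m_e^2\quad\text{for all }\ \emptyset\neq V'\subsetneq V^{\rm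 ext}\ \text{ and all }\ \emptyset\neq E'\subseteq E .$$ For $\gamma\subseteq E$ let $L_\gamma$ be its loop number (first Betti number), and let $G/\gamma$ be the graph obtained by contracting each connected component of $(V,\gamma)$ to a vertex, whose momentum is the sum of the momenta of that component, and keeping the edges of $E\setminus\gamma$ with their masses. Call $\gamma$ *mass-momentum spanning* if $\mathcal F_{G/\gamma}=0$ identically, and set $z_{\mathcal F}(\gamma)=L_\gamma+1$ if $\gamma$ is mass-momentum spanning and $z_{\mathcal F}(\gamma)=L_\gamma$ otherwise. For $z:\mathbf 2^E\to\mathbb R$ the base polytope is $$\mathbf P[z]=\Big\{a\in\mathbb R^E:\ \sum_{e\in E}a_e=z(E),\ \ \sum_{e\in\gamma}a_e\ge z(\gamma)\ \text{ for all }\gamma\subsetneq E\Big\}.$$ The function $z$ is *supermodular* if $z(\gamma)+z(\delta)\le z(\gamma\cup\delta)+z(\gamma\cap\delta)$ for all $\gamma,\delta\subseteq E$, and a *generalized permutahedron* is a set of the form $\mathbf P[z]$ with $z$ supermodular. The Newton polytope $\mathbf N[p]$ is the convex hull of the exponent vectors of the monomials with non-zero coefficient in $p$ (empty if $p=0$).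 **Theorem.** If the kinematics are generic, then $\mathbf N[\mathcal F]=\mathbf P[z_{\mathcal F}]$ and the function $z_{\mathcal F}$ is supermodular. In particular, $\mathbf N[\mathcal F]$ is a generalized permutahedron. -/

import Mathlib

/-- Kinematic data on a finite multigraph with vertex type `V` and edge type `E`: each edge has an
unordered pair of end points (parallel edges and self-loops are allowed, and both are produced by
contractions) and a real mass, and the external momenta enter through their Gram matrix
`P u v = p_u · p_v`, an arbitrary symmetric real matrix subject only to momentum conservation.
No sign or definiteness condition is imposed on `P`, and no vectors `p_v` need exist. -/
structure FeynmanGraph (V E : Type*) [Fintype V] where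
  ends : E → Sym2 V
  mass : E → ℝ
  P : V → V → ℝ
  symm : ∀ u v, P u v = P v u
  sum_eq_zero : ∀ u, ∑ v, P u v = 0

namespace FeynmanGraph

variable {V E : Type*} [Fintype V]

/-- Adjacency in the spanning subgraph `(V, γ)`. -/
def sub (G : FeynmanGraph V E) (γ : Finset E) : SimpleGraph V :=
  SimpleGraph.fromRel fun u v => ∃ e ∈ γ, G.ends e = s(u, v)

/-- The connected components of the spanning subgraph `(V, γ)`. -/
def Comp (G : FeynmanGraph V E) (γ : Finset E) : Type _ :=
  (G.sub γ).ConnectedComponent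

/-- The component of `(V, γ)` that contains the vertex `v`. -/
def comp (G : FeynmanGraph V E) (γ : Finset E) (v : V) : G.Comp γ :=
  (G.sub γ).connectedComponentMk v

theorem comp_surjective (G : FeynmanGraph V E) (γ : Finset E) :
    Function.Surjective (G.comp γ) := by
  intro c
  obtain ⟨v, hv⟩ := Quot.exists_rep c
  exact ⟨v, hv⟩

noncomputable instance (G : FeynmanGraph V E) (γ : Finset E) : Fintype (G.Comp γ) :=
  haveI : Finite (G.Comp γ) := Finite.of_surjective _ (G.comp_surjective γ)
  Fintype.ofFinite _

/-- The number of connected components of `(V, γ)`. -/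
noncomputable def numComp (G : FeynmanGraph V E) (γ : Finset E) : ℕ :=
  Fintype.card (G.Comp γ)

/-- The graph is connected (and has at least one vertex). -/
def Connected [Fintype E] (G : FeynmanGraph V E) : Prop :=
  G.numComp Finset.univ = 1

/-- The loop number `L_γ` (first Betti number, `#edges - #vertices + #components`) of a subgraph.
Vertices that are not incident to `γ` do not contribute, each being a component of its own. -/
noncomputable def loopNumber (G : FeynmanGraph V E) (γ : Finset E) : ℤ :=
  (γ.card : ℤ) - (Fintype.card V : ℤ) + (G.numComp γ : ℤ)

/-- `γ` contains no cycle: no edge of `γ` (self-loops included) has its end points joined by the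
other edges of `γ`. -/
def IsForest [DecidableEq E] (G : FeynmanGraph V E) (γ : Finset E) : Prop :=
  ∀ e ∈ γ, ∀ u v, G.ends e = s(u, v) → G.comp (γ.erase e) u ≠ G.comp (γ.erase e) v

/-- `γ` is (the edge set of) a spanning forest with exactly `k` components: a spanning tree for
`k = 1`, a spanning two-forest for `k = 2`. -/
def IsSpanningForest [DecidableEq E] (G : FeynmanGraph V E) (k : ℕ) (γ : Finset E) : Prop :=
  G.IsForest γ ∧ G.numComp γ = k

/-- The squared momentum `(∑ v ∈ S, p_v)² = ∑ u v ∈ S, P u v` flowing into a vertex set `S`. -/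
def momentumSq (G : FeynmanGraph V E) (S : Finset V) : ℝ :=
  ∑ u ∈ S, ∑ v ∈ S, G.P u v

open Classical in
/-- The vertex set of a component of `(V, γ)`. -/
noncomputable def compVerts (G : FeynmanGraph V E) (γ : Finset E) (c : G.Comp γ) : Finset V :=
  Finset.univ.filter fun v => G.comp γ v = c

/-- The squared momentum `p(γ)²` running between the two components of a spanning two-forest `γ`,
written without choosing one of the components, as the mean of the squared momenta of both; these
are equal by momentum conservation, see `transferSq_eq`. -/
noncomputable def transferSq (G : FeynmanGraph V E) (γ : Finset E) : ℝ :=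
  (1 / 2) * ∑ c, G.momentumSq (G.compVerts γ c)

open Classical in
theorem momentumSq_compl (G : FeynmanGraph V E) (S : Finset V) :
    G.momentumSq Sᶜ = G.momentumSq S := by
  have h1 : ∀ u, ∑ v ∈ Sᶜ, G.P u v = -∑ v ∈ S, G.P u v := by
    intro u
    have h := Finset.sum_add_sum_compl S (G.P u)
    rw [G.sum_eq_zero u] at h
    linarith
  have h2 : ∀ v, ∑ u ∈ Sᶜ, G.P u v = -∑ u ∈ S, G.P u v := by
    intro v
    simpa only [G.symm v] using h1 v
  unfold momentumSq
  rw [Finset.sum_congr rfl fun u _ => h1 u, Finset.sum_neg_distrib, Finset.sum_comm,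
    Finset.sum_congr rfl fun v _ => h2 v, Finset.sum_neg_distrib, neg_neg, Finset.sum_comm]

/-- The momentum transfer of a two-forest is the squared momentum of either component. -/
theorem transferSq_eq (G : FeynmanGraph V E) (γ : Finset E) (h : G.numComp γ = 2)
    (c : G.Comp γ) : G.transferSq γ = G.momentumSq (G.compVerts γ c) := by
  classical
  have hcard : (Finset.univ.erase c).card = 1 := by
    rw [Finset.card_erase_of_mem (Finset.mem_univ c), Finset.card_univ]
    change G.numComp γ - 1 = 1
    omega
  obtain ⟨d, hd⟩ := Finset.card_eq_one.mp hcard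
  have hdc : G.compVerts γ d = (G.compVerts γ c)ᶜ := by
    ext v
    have hne : d ≠ c := Finset.ne_of_mem_erase (hd ▸ Finset.mem_singleton_self d)
    have hv : G.comp γ v ≠ c → G.comp γ v = d := fun hv =>
      Finset.mem_singleton.mp (hd ▸ Finset.mem_erase.mpr ⟨hv, Finset.mem_univ _⟩)
    simp only [compVerts, Finset.mem_filter, Finset.mem_univ, true_and, Finset.mem_compl]
    exact ⟨fun h => h ▸ hne, hv⟩
  unfold transferSq
  rw [← Finset.add_sum_erase _ _ (Finset.mem_univ c), hd, Finset.sum_singleton, hdc,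
    momentumSq_compl]
  ring

open Classical in
/-- The first Symanzik polynomial `𝓤 = ∑_T ∏_{e ∉ T} x_e` over spanning trees `T`. -/
noncomputable def symanzikU [Fintype E] [DecidableEq E] (G : FeynmanGraph V E) :
    MvPolynomial E ℝ :=
  ∑ T : Finset E with G.IsSpanningForest 1 T, ∏ e ∈ Tᶜ, MvPolynomial.X e

open Classical in
/-- The second Symanzik polynomial
`𝓕 = -∑_F p(F)² ∏_{e ∉ F} x_e + 𝓤 ∑_e m_e² x_e`, where `F` runs over spanning two-forests. -/
noncomputable def symanzikF [Fintype E] [DecidableEq E] (G : FeynmanGraph V E) :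
    MvPolynomial E ℝ :=
  -(∑ F : Finset E with G.IsSpanningForest 2 F,
      MvPolynomial.C (G.transferSq F) * ∏ e ∈ Fᶜ, MvPolynomial.X e)
    + G.symanzikU * ∑ e, MvPolynomial.C (G.mass e ^ 2) * MvPolynomial.X e

/-- The cograph `G/γ`: every connected component of `(V, γ)` becomes a vertex, whose incoming
momentum is the sum of the momenta of its vertices; the edges outside `γ` remain. -/
noncomputable def contract (G : FeynmanGraph V E) (γ : Finset E) :
    FeynmanGraph (G.Comp γ) {e : E // e ∉ γ} where
  ends e := (G.ends e).map (G.comp γ)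
  mass e := G.mass e
  P c d := ∑ u ∈ G.compVerts γ c, ∑ v ∈ G.compVerts γ d, G.P u v
  symm c d := by
    rw [Finset.sum_comm]
    exact Finset.sum_congr rfl fun v _ => Finset.sum_congr rfl fun u _ => G.symm u v
  sum_eq_zero c := by
    classical
    rw [Finset.sum_comm]
    refine Finset.sum_eq_zero fun u _ => ?_
    have h := Finset.sum_fiberwise Finset.univ (G.comp γ) (G.P u)
    rw [G.sum_eq_zero u] at h
    rw [← h]
    refine Finset.sum_congr rfl fun d _ => Finset.sum_congr ?_ fun _ _ => rfl
    ext v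
    simp [compVerts]

/-- `γ` is mass-momentum spanning if the second Symanzik polynomial of `G/γ` vanishes
identically. -/
def MassMomentumSpanning [Fintype E] [DecidableEq E] (G : FeynmanGraph V E) (γ : Finset E) :
    Prop :=
  (G.contract γ).symanzikF = 0

open Classical in
/-- The function `z_𝓕`: `L_γ + 1` if `γ` is mass-momentum spanning, and `L_γ` otherwise. -/
noncomputable def zF [Fintype E] [DecidableEq E] (G : FeynmanGraph V E) (γ : Finset E) : ℝ :=
  if G.MassMomentumSpanning γ then (G.loopNumber γ : ℝ) + 1 else (G.loopNumber γ : ℝ)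

open Classical in
/-- The external vertices: those `v` with `P u v ≠ 0` for some `u`. -/
noncomputable def externalVertices (G : FeynmanGraph V E) : Finset V :=
  Finset.univ.filter fun v => ∃ u, G.P u v ≠ 0

/-- Generic kinematics: the squared momentum flowing into a (non-empty) proper subset of the
external vertices never equals a sum of squared masses over a non-empty set of edges. -/
def Generic (G : FeynmanGraph V E) : Prop :=
  ∀ S : Finset V, S.Nonempty → S ⊂ G.externalVertices →
    ∀ T : Finset E, T.Nonempty → G.momentumSq S ≠ ∑ e ∈ T, G.mass e ^ 2

end FeynmanGraph

/-- The Newton polytope of a polynomial: the convex hull of the exponent vectors of the monomials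
that occur with a non-zero coefficient. -/
def newtonPolytope {E : Type*} (p : MvPolynomial E ℝ) : Set (E → ℝ) :=
  convexHull ℝ ((fun (k : E →₀ ℕ) (e : E) => (k e : ℝ)) '' {k | p.coeff k ≠ 0})

/-- The base polytope of a set function `z`. -/
def basePolytope {E : Type*} [Fintype E] (z : Finset E → ℝ) : Set (E → ℝ) :=
  {a | ∑ e, a e = z Finset.univ ∧ ∀ γ : Finset E, γ ⊂ Finset.univ → z γ ≤ ∑ e ∈ γ, a e}

/-- Supermodular set functions. -/
def IsSupermodular {E : Type*} [DecidableEq E] (z : Finset E → ℝ) : Prop :=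
  ∀ γ δ : Finset E, z γ + z δ ≤ z (γ ∪ δ) + z (γ ∩ δ)

/-- Generalized permutahedra: the base polytopes of supermodular set functions. -/
def IsGeneralizedPermutahedron {E : Type*} [Fintype E] [DecidableEq E] (A : Set (E → ℝ)) : Prop :=
  ∃ z : Finset E → ℝ, IsSupermodular z ∧ A = basePolytope z

/-! Genericity reduces the claim to graph combinatorics. Terms of opposite sign can meet in `𝓕` only
at the monomial of a two-forest `F`, whose coefficient is the sum of `m_e²` over the edges
completing `F` to a tree, minus `p(F)²`. If `F` does not separate the external vertices, `p(F)²`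
vanishes and the rest is a sum of squares; if it does, genericity forbids cancellation. So the
support of `𝓕` is explicit (`coeff_symanzikF_ne_zero_iff`). Applied to the connected cograph `G/γ`,
this shows that `γ` is mass-momentum spanning exactly when it contains all massive edges and joins
all external vertices, whence `z_𝓕` is the loop number plus the indicator of that condition.

The exponents satisfy the inequalities of the base polytope by forest counting
(`symanzikExponents_subset`). Conversely, Edmonds' greedy algorithm bounds every linear functional
on the base polytope by its value at a greedy vector, so a finite subset containing all greedy
vectors has the whole polytope as its hull (`convexHull_eq_basePolytope`). Running the algorithm on
`z_𝓕` is Kruskal's algorithm: it grows a spanning tree `T` and yields the indicator of `Tᶜ` plus one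
unit at the edge whose arrival makes the set spanning, which is an exponent of `𝓕`
(`IsGreedy.exists_forest`). Supermodularity is proved separately, by comparing increments. -/

namespace FeynmanGraph

/-! ### Components, loop numbers and forests. -/

section Connectivity

variable {V E : Type*} [Fintype V] (G : FeynmanGraph V E)

theorem comp_eq_iff_reachable {γ : Finset E} {u v : V} :
    G.comp γ u = G.comp γ v ↔ (G.sub γ).Reachable u v :=
  SimpleGraph.ConnectedComponent.eq

theorem comp_ends {γ : Finset E} {e : E} (he : e ∈ γ) {a b : V} (hab : G.ends e = s(a, b)) :
    G.comp γ a = G.comp γ b := by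
  by_cases h : a = b
  · rw [h]
  · refine (G.comp_eq_iff_reachable).2 (SimpleGraph.Adj.reachable ?_)
    exact (SimpleGraph.fromRel_adj _ _ _).2 ⟨h, Or.inl ⟨e, he, hab⟩⟩

/-- A function that is constant along the edges of `γ` is constant on its components. -/
theorem eq_of_comp_eq {α : Sort*} {γ : Finset E} (f : V → α)
    (hf : ∀ e ∈ γ, ∀ a b, G.ends e = s(a, b) → f a = f b) {u v : V}
    (h : G.comp γ u = G.comp γ v) : f u = f v := by
  obtain ⟨w⟩ := (G.comp_eq_iff_reachable).1 h
  induction w with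
  | nil => rfl
  | cons hadj _ ih =>
    refine Eq.trans ?_ (ih ((G.comp_eq_iff_reachable).2 ⟨‹_›⟩))
    obtain ⟨-, ⟨e, he, h⟩ | ⟨e, he, h⟩⟩ := (SimpleGraph.fromRel_adj _ _ _).1 hadj
    · exact hf e he _ _ h
    · exact (hf e he _ _ h).symm

theorem comp_mono {γ δ : Finset E} (h : γ ⊆ δ) {u v : V} (huv : G.comp γ u = G.comp γ v) :
    G.comp δ u = G.comp δ v :=
  G.eq_of_comp_eq (G.comp δ) (fun _ he _ _ hab => G.comp_ends (h he) hab) huv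

theorem comp_empty {u v : V} (h : G.comp (∅ : Finset E) u = G.comp ∅ v) : u = v :=
  G.eq_of_comp_eq id (fun e he => absurd he (Finset.notMem_empty e)) h

theorem exists_ends (e : E) : ∃ a b, G.ends e = s(a, b) := by
  induction h : G.ends e with
  | h a b => exact ⟨a, b, rfl⟩

theorem comp_surjInv {γ : Finset E} (c : G.Comp γ) :
    G.comp γ (Function.surjInv (G.comp_surjective γ) c) = c :=
  Function.surjInv_eq _ _

theorem numComp_le_of_comp_imp {γ δ : Finset E}
    (h : ∀ u v, G.comp γ u = G.comp γ v → G.comp δ u = G.comp δ v) :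
    G.numComp δ ≤ G.numComp γ := by
  refine Fintype.card_le_of_surjective
    (fun c => G.comp δ (Function.surjInv (G.comp_surjective γ) c)) fun d => ?_
  obtain ⟨v, rfl⟩ := G.comp_surjective δ d
  exact ⟨G.comp γ v, h _ _ (G.comp_surjInv _)⟩

theorem numComp_eq_of_comp_iff {γ δ : Finset E}
    (h : ∀ u v, G.comp γ u = G.comp γ v ↔ G.comp δ u = G.comp δ v) :
    G.numComp γ = G.numComp δ :=
  le_antisymm (G.numComp_le_of_comp_imp fun u v => (h u v).2)
    (G.numComp_le_of_comp_imp fun u v => (h u v).1)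

theorem numComp_anti {γ δ : Finset E} (h : γ ⊆ δ) : G.numComp δ ≤ G.numComp γ :=
  G.numComp_le_of_comp_imp fun _ _ => G.comp_mono h

theorem numComp_lt {γ δ : Finset E} (h : γ ⊆ δ) {u v : V} (hδ : G.comp δ u = G.comp δ v)
    (hγ : G.comp γ u ≠ G.comp γ v) : G.numComp δ < G.numComp γ := by
  refine Fintype.card_lt_of_surjective_not_injective
    (fun c => G.comp δ (Function.surjInv (G.comp_surjective γ) c)) (fun d => ?_) fun hinj => ?_
  · obtain ⟨v, rfl⟩ := G.comp_surjective δ d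
    exact ⟨G.comp γ v, G.comp_mono h (G.comp_surjInv _)⟩
  · refine hγ (hinj ?_)
    dsimp only
    rw [G.comp_mono h (G.comp_surjInv (G.comp γ u)), hδ,
      G.comp_mono h (G.comp_surjInv (G.comp γ v))]

theorem numComp_empty : G.numComp (∅ : Finset E) = Fintype.card V :=
  (Fintype.card_of_bijective (f := G.comp ∅) ⟨fun _ _ => G.comp_empty, G.comp_surjective ∅⟩).symm

theorem comp_eq_of_numComp_eq_one {γ : Finset E} (h : G.numComp γ = 1) (u v : V) :
    G.comp γ u = G.comp γ v :=
  haveI := Fintype.card_le_one_iff_subsingleton.1 h.le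
  Subsingleton.elim (α := G.Comp γ) _ _

variable [DecidableEq E]

theorem comp_insert {γ : Finset E} {e : E} {a b : V} (hab : G.ends e = s(a, b)) (u v : V) :
    G.comp (insert e γ) u = G.comp (insert e γ) v ↔
      G.comp γ u = G.comp γ v ∨ (G.comp γ u = G.comp γ a ∧ G.comp γ v = G.comp γ b) ∨
        (G.comp γ u = G.comp γ b ∧ G.comp γ v = G.comp γ a) := by
  classical
  have hsub : γ ⊆ insert e γ := Finset.subset_insert e γ
  have hE := G.comp_ends (Finset.mem_insert_self e γ) hab
  constructor
  · intro h
    -- This map merges the component of `b` into that of `a`, so it is constant along `e` as well as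
    -- along `γ`.
    have := G.eq_of_comp_eq
      (fun w => if G.comp γ w = G.comp γ b then G.comp γ a else G.comp γ w) ?_ h
    · split_ifs at this <;> grind
    · intro f hf x y hxy
      rcases Finset.mem_insert.1 hf with rfl | hf
      · rw [hab] at hxy
        rcases Sym2.eq_iff.1 hxy with ⟨rfl, rfl⟩ | ⟨rfl, rfl⟩ <;> simp
      · simp only [G.comp_ends hf hxy]
  · rintro (h | ⟨h1, h2⟩ | ⟨h1, h2⟩)
    · exact G.comp_mono hsub h
    · exact (G.comp_mono hsub h1).trans (hE.trans (G.comp_mono hsub h2).symm)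
    · exact (G.comp_mono hsub h1).trans (hE.symm.trans (G.comp_mono hsub h2).symm)

theorem comp_insert_of_eq {γ : Finset E} {e : E} {a b : V} (hab : G.ends e = s(a, b))
    (h : G.comp γ a = G.comp γ b) (u v : V) :
    G.comp (insert e γ) u = G.comp (insert e γ) v ↔ G.comp γ u = G.comp γ v := by
  rw [G.comp_insert hab]
  grind

theorem numComp_insert_of_eq {γ : Finset E} {e : E} {a b : V} (hab : G.ends e = s(a, b))
    (h : G.comp γ a = G.comp γ b) : G.numComp (insert e γ) = G.numComp γ :=
  G.numComp_eq_of_comp_iff (G.comp_insert_of_eq hab h)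

theorem numComp_insert_of_ne {γ : Finset E} {e : E} {a b : V} (hab : G.ends e = s(a, b))
    (h : G.comp γ a ≠ G.comp γ b) : G.numComp (insert e γ) + 1 = G.numComp γ := by
  classical
  -- Every merged component has a unique representative among the old components other than that of
  -- `b`.
  have hinj : Function.Bijective (fun c : {c : G.Comp γ // c ≠ G.comp γ b} =>
      G.comp (insert e γ) (Function.surjInv (G.comp_surjective γ) c.1)) := by
    have key := fun c => G.comp_surjInv (γ := γ) c
    constructor
    · rintro ⟨c, hc⟩ ⟨d, hd⟩ hcd
      have := (G.comp_insert hab _ _).1 hcd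
      simp only [key] at this
      grind
    · intro d
      obtain ⟨v, rfl⟩ := G.comp_surjective _ d
      by_cases hv : G.comp γ v = G.comp γ b
      · exact ⟨⟨G.comp γ a, h⟩, (G.comp_insert hab _ _).2 (Or.inr (Or.inl ⟨key _, hv⟩))⟩
      · exact ⟨⟨G.comp γ v, hv⟩, (G.comp_insert hab _ _).2 (Or.inl (key _))⟩
  have hcard := Fintype.card_of_bijective hinj
  have h2 : Fintype.card {c : G.Comp γ // c ≠ G.comp γ b} = Fintype.card (G.Comp γ) - 1 := by
    rw [Fintype.card_subtype_compl, Fintype.card_subtype_eq]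
  have h3 : 0 < Fintype.card (G.Comp γ) := Fintype.card_pos_iff.2 ⟨G.comp γ b⟩
  unfold numComp
  omega

omit [DecidableEq E] in
theorem loopNumber_empty : G.loopNumber (∅ : Finset E) = 0 := by
  simp [loopNumber, numComp_empty]

open Classical in
theorem loopNumber_insert {γ : Finset E} {e : E} (he : e ∉ γ) {a b : V}
    (hab : G.ends e = s(a, b)) :
    G.loopNumber (insert e γ) =
      G.loopNumber γ + if G.comp γ a = G.comp γ b then 1 else 0 := by
  unfold loopNumber
  rw [Finset.card_insert_of_notMem he]
  split_ifs with h
  · rw [G.numComp_insert_of_eq hab h]; push_cast; ring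
  · rw [← G.numComp_insert_of_ne hab h]; push_cast; ring

theorem isForest_mono {S T : Finset E} (h : S ⊆ T) (hT : G.IsForest T) : G.IsForest S :=
  fun e he u v huv hS => hT e (h he) u v huv (G.comp_mono (Finset.erase_subset_erase e h) hS)

theorem loopNumber_le_insert (γ : Finset E) (e : E) :
    G.loopNumber γ ≤ G.loopNumber (insert e γ) := by
  by_cases he : e ∈ γ
  · rw [Finset.insert_eq_of_mem he]
  · obtain ⟨a, b, hab⟩ := G.exists_ends e
    rw [G.loopNumber_insert he hab]
    split_ifs <;> omega

theorem loopNumber_nonneg (γ : Finset E) : 0 ≤ G.loopNumber γ := by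
  induction γ using Finset.induction_on with
  | empty => exact G.loopNumber_empty.ge
  | insert e γ _ ih => exact ih.trans (G.loopNumber_le_insert γ e)

theorem isForest_iff_loopNumber {γ : Finset E} : G.IsForest γ ↔ G.loopNumber γ = 0 := by
  constructor
  · intro h
    induction γ using Finset.induction_on with
    | empty => exact G.loopNumber_empty
    | insert e γ he ih =>
      obtain ⟨a, b, hab⟩ := G.exists_ends e
      have h1 := h e (Finset.mem_insert_self e γ) a b hab
      rw [Finset.erase_insert he] at h1
      rw [G.loopNumber_insert he hab, if_neg h1, add_zero]
      exact ih (G.isForest_mono (Finset.subset_insert e γ) h)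
  · intro h e he a b hab hc
    have h1 := G.loopNumber_insert (Finset.notMem_erase e γ) hab
    rw [if_pos hc, Finset.insert_erase he] at h1
    have := G.loopNumber_nonneg (γ.erase e)
    omega

theorem isForest_insert {T : Finset E} (hT : G.IsForest T) {e : E} {a b : V}
    (hab : G.ends e = s(a, b)) (h : G.comp T a ≠ G.comp T b) : G.IsForest (insert e T) := by
  have he : e ∉ T := fun he => h (G.comp_ends he hab)
  rw [isForest_iff_loopNumber] at *
  rw [G.loopNumber_insert he hab, if_neg h, hT, add_zero]

theorem card_add_numComp {T : Finset E} (hT : G.IsForest T) :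
    T.card + G.numComp T = Fintype.card V := by
  have := G.isForest_iff_loopNumber.1 hT
  unfold loopNumber at this
  omega

theorem numComp_erase {T : Finset E} (hT : G.IsForest T) {e : E} (he : e ∈ T) :
    G.numComp (T.erase e) = G.numComp T + 1 := by
  have h1 := G.card_add_numComp hT
  have h2 := G.card_add_numComp (G.isForest_mono (Finset.erase_subset e T) hT)
  have h3 := Finset.card_erase_add_one he
  omega

/-- The forest `γ ∩ T` has at least as many components as `γ`, and its edge count is `|V|` minus
that number. -/
theorem loopNumber_le_card_sdiff {T : Finset E} (hT : G.IsForest T) (γ : Finset E) :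
    G.loopNumber γ ≤ (γ \ T).card := by
  have h1 := G.card_add_numComp (G.isForest_mono (Finset.inter_subset_right (s₁ := γ)) hT)
  have h2 := G.numComp_anti (Finset.inter_subset_left (s₁ := γ) (s₂ := T))
  have h3 := Finset.card_sdiff_add_card_inter γ T
  unfold loopNumber
  omega

/-- The gain of one comes from `γ ∩ T`, which still separates `u` from `v` and so has strictly more
components than `γ`. -/
theorem loopNumber_lt_card_sdiff {T : Finset E} (hT : G.IsForest T) {γ : Finset E} {u v : V}
    (hγ : G.comp γ u = G.comp γ v) (huv : G.comp T u ≠ G.comp T v) :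
    G.loopNumber γ + 1 ≤ (γ \ T).card := by
  have h1 := G.card_add_numComp (G.isForest_mono (Finset.inter_subset_right (s₁ := γ)) hT)
  have h2 := G.numComp_lt (Finset.inter_subset_left (s₁ := γ) (s₂ := T)) hγ
    (fun h => huv (G.comp_mono Finset.inter_subset_right h))
  have h3 := Finset.card_sdiff_add_card_inter γ T
  unfold loopNumber
  omega

/-- In a forest, an edge that separates two vertices within a subforest joining them separates
them within the whole forest. -/
theorem comp_erase_ne {S T : Finset E} (hT : G.IsForest T) (hST : S ⊆ T) {e : E} (he : e ∈ S)
    {u v : V} (hS : G.comp S u = G.comp S v) (hSe : G.comp (S.erase e) u ≠ G.comp (S.erase e) v) :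
    G.comp (T.erase e) u ≠ G.comp (T.erase e) v := by
  obtain ⟨a, b, hab⟩ := G.exists_ends e
  intro h
  have hsub := Finset.erase_subset_erase e hST
  have hne := hT e (hST he) a b hab
  rw [← Finset.insert_erase he, G.comp_insert hab] at hS
  -- Within `S`, the vertices `u` and `v` hang on opposite ends of `e`; joining them in `T.erase e`
  -- would close a cycle through `e`.
  rcases hS with hS | ⟨h1, h2⟩ | ⟨h1, h2⟩
  · exact hSe hS
  · exact hne ((G.comp_mono hsub h1).symm.trans (h.trans (G.comp_mono hsub h2)))
  · exact hne ((G.comp_mono hsub h2).symm.trans (h.symm.trans (G.comp_mono hsub h1)))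

/-- Delete edges while `u` and `v` stay joined. The first deletion that separates them in the
smaller forest also does so in `T`, by `comp_erase_ne`. -/
theorem exists_erase_separating {T : Finset E} (hT : G.IsForest T) {u v : V} (huv : u ≠ v)
    (h : G.comp T u = G.comp T v) :
    ∃ e ∈ T, G.comp (T.erase e) u ≠ G.comp (T.erase e) v := by
  induction T using Finset.strongInduction with
  | H T ih =>
    obtain ⟨e, he⟩ : T.Nonempty := by
      rw [Finset.nonempty_iff_ne_empty]
      rintro rfl
      exact huv (G.comp_empty h)
    by_cases hc : G.comp (T.erase e) u = G.comp (T.erase e) v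
    · obtain ⟨f, hf, hne⟩ := ih _ (Finset.erase_ssubset he)
        (G.isForest_mono (Finset.erase_subset e T) hT) hc
      exact ⟨f, Finset.mem_of_mem_erase hf,
        G.comp_erase_ne hT (Finset.erase_subset e T) hf hc hne⟩
    · exact ⟨e, he, hc⟩

/-- `T` is a maximal forest of `(V, S)`. -/
structure IsMaximalForest (S T : Finset E) : Prop where
  subset : T ⊆ S
  isForest : G.IsForest T
  comp_iff : ∀ u v, G.comp T u = G.comp T v ↔ G.comp S u = G.comp S v

theorem isMaximalForest_empty : G.IsMaximalForest ∅ ∅ :=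
  ⟨subset_rfl, fun e he => absurd he (Finset.notMem_empty e), fun _ _ => Iff.rfl⟩

theorem IsMaximalForest.insert_of_eq {S T : Finset E} (h : G.IsMaximalForest S T) {e : E} {a b : V}
    (hab : G.ends e = s(a, b)) (hS : G.comp S a = G.comp S b) :
    G.IsMaximalForest (insert e S) T :=
  ⟨h.subset.trans (Finset.subset_insert e S), h.isForest, fun u v => by
    rw [h.comp_iff, G.comp_insert_of_eq hab hS]⟩

theorem IsMaximalForest.insert_of_ne {S T : Finset E} (h : G.IsMaximalForest S T) {e : E} {a b : V}
    (hab : G.ends e = s(a, b)) (hS : G.comp S a ≠ G.comp S b) :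
    G.IsMaximalForest (insert e S) (insert e T) :=
  ⟨Finset.insert_subset_insert e h.subset,
    G.isForest_insert h.isForest hab fun hT => hS ((h.comp_iff a b).1 hT), fun u v => by
    simp only [G.comp_insert hab, h.comp_iff]⟩

theorem exists_isMaximalForest (S : Finset E) : ∃ T, G.IsMaximalForest S T := by
  induction S using Finset.induction_on with
  | empty => exact ⟨∅, G.isMaximalForest_empty⟩
  | insert e S _ ih =>
    obtain ⟨T, hT⟩ := ih
    obtain ⟨a, b, hab⟩ := G.exists_ends e
    by_cases hS : G.comp S a = G.comp S b
    · exact ⟨T, hT.insert_of_eq G hab hS⟩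
    · exact ⟨_, hT.insert_of_ne G hab hS⟩

theorem IsMaximalForest.isSpanningForest [Fintype E] (hG : G.Connected) {T : Finset E}
    (h : G.IsMaximalForest Finset.univ T) : G.IsSpanningForest 1 T :=
  ⟨h.isForest, (G.numComp_eq_of_comp_iff h.comp_iff).trans hG⟩

theorem exists_isSpanningForest_one [Fintype E] (hG : G.Connected) :
    ∃ T, G.IsSpanningForest 1 T :=
  (G.exists_isMaximalForest Finset.univ).imp fun _ h => h.isSpanningForest G hG

theorem IsSpanningForest.erase {k : ℕ} {T : Finset E} (h : G.IsSpanningForest k T) {e : E}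
    (he : e ∈ T) : G.IsSpanningForest (k + 1) (T.erase e) :=
  ⟨G.isForest_mono (Finset.erase_subset e T) h.1, by rw [G.numComp_erase h.1 he, h.2]⟩

/-- A two-forest of a connected graph is contained in a spanning tree. -/
theorem IsSpanningForest.exists_insert [Fintype E] (hG : G.Connected) {F : Finset E}
    (h : G.IsSpanningForest 2 F) : ∃ e ∉ F, G.IsSpanningForest 1 (insert e F) := by
  by_cases hF : ∀ e a b, G.ends e = s(a, b) → G.comp F a = G.comp F b
  · exfalso
    have := G.numComp_le_of_comp_imp (γ := Finset.univ) (δ := F) fun u v huv =>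
      G.eq_of_comp_eq (G.comp F) (fun e _ a b hab => hF e a b hab) huv
    rw [h.2, hG] at this
    omega
  · push Not at hF
    obtain ⟨e, a, b, hab, hne⟩ := hF
    have h2 := G.numComp_insert_of_ne hab hne
    rw [h.2] at h2
    exact ⟨e, fun he => hne (G.comp_ends he hab), G.isForest_insert h.1 hab hne, by omega⟩

end Connectivity

/-! ### Supermodularity by monotone increments. -/

section Supermodular

variable {V E : Type*} [Fintype V] [DecidableEq E]

/-- Add the edges of `γ \ δ` one at a time, once on top of `γ ∩ δ` and once on top of `δ`, and
telescope. -/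
theorem supermodular_of_increment_le {z : Finset E → ℤ}
    (h : ∀ γ δ : Finset E, γ ⊆ δ → ∀ e ∉ δ, z (insert e γ) - z γ ≤ z (insert e δ) - z δ)
    (γ δ : Finset E) : z γ + z δ ≤ z (γ ∪ δ) + z (γ ∩ δ) := by
  have key : ∀ X : Finset E, ∀ α β : Finset E, α ⊆ β → Disjoint X β →
      z (α ∪ X) - z α ≤ z (β ∪ X) - z β := by
    intro X
    induction X using Finset.induction_on with
    | empty => intro α β _ _; simp
    | insert e X he ih =>
      intro α β hαβ hX
      rw [Finset.disjoint_insert_left] at hX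
      have h1 := ih α β hαβ hX.2
      have h2 := h (α ∪ X) (β ∪ X) (Finset.union_subset_union_left hαβ) e (by simp [hX.1, he])
      rw [Finset.union_insert, Finset.union_insert]
      linarith
  have h1 := key (γ \ δ) (γ ∩ δ) δ Finset.inter_subset_right Finset.sdiff_disjoint
  rw [Finset.union_comm (γ ∩ δ), Finset.sdiff_union_inter, Finset.union_sdiff_self_eq_union,
    Finset.union_comm δ] at h1
  linarith

variable (G : FeynmanGraph V E)

theorem loopNumber_supermodular (γ δ : Finset E) :
    G.loopNumber γ + G.loopNumber δ ≤ G.loopNumber (γ ∪ δ) + G.loopNumber (γ ∩ δ) := by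
  refine supermodular_of_increment_le (fun γ δ h e he => ?_) γ δ
  obtain ⟨a, b, hab⟩ := G.exists_ends e
  rw [G.loopNumber_insert he hab, G.loopNumber_insert (fun h' => he (h h')) hab]
  have := G.comp_mono h (u := a) (v := b)
  split_ifs <;> first | omega | tauto

open Classical in
-- Each bracket is the loop number after adjoining one fixed extra edge from `u` to `v`, so this is
-- again supermodularity of a loop number.
theorem loopNumber_add_supermodular (u v : V) (γ δ : Finset E) :
    (G.loopNumber γ + if G.comp γ u = G.comp γ v then 1 else 0) +
      (G.loopNumber δ + if G.comp δ u = G.comp δ v then 1 else 0) ≤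
    (G.loopNumber (γ ∪ δ) + if G.comp (γ ∪ δ) u = G.comp (γ ∪ δ) v then 1 else 0) +
      (G.loopNumber (γ ∩ δ) + if G.comp (γ ∩ δ) u = G.comp (γ ∩ δ) v then 1 else 0) := by
  refine supermodular_of_increment_le
    (z := fun γ => G.loopNumber γ + if G.comp γ u = G.comp γ v then 1 else 0)
    (fun γ δ h e he => ?_) γ δ
  obtain ⟨a, b, hab⟩ := G.exists_ends e
  rw [G.loopNumber_insert he hab, G.loopNumber_insert (fun h' => he (h h')) hab]
  simp only [G.comp_insert hab]
  have h1 := G.comp_mono h (u := a) (v := b)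
  have h2 := G.comp_mono h (u := u) (v := v)
  have h3 := G.comp_mono h (u := u) (v := a)
  have h4 := G.comp_mono h (u := u) (v := b)
  have h5 := G.comp_mono h (u := v) (v := a)
  have h6 := G.comp_mono h (u := v) (v := b)
  grind

end Supermodular
end FeynmanGraph
namespace FeynmanGraph

/-! ### Exponent vectors of squarefree monomials. -/

section Exponents

variable {E : Type*}

/-- The exponent vector of the squarefree monomial `∏ e ∈ S, x_e`. -/
noncomputable def indicatorExp (S : Finset E) : E →₀ ℕ :=
  ∑ e ∈ S, Finsupp.single e 1

theorem prod_X_eq_monomial (S : Finset E) :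
    ∏ e ∈ S, (MvPolynomial.X e : MvPolynomial E ℝ) = MvPolynomial.monomial (indicatorExp S) 1 := by
  classical
  unfold indicatorExp
  induction S using Finset.induction_on with
  | empty => simp
  | insert e S he ih =>
    rw [Finset.prod_insert he, Finset.sum_insert he, ih, MvPolynomial.X,
      MvPolynomial.monomial_mul, one_mul]

variable [DecidableEq E]

theorem indicatorExp_apply (S : Finset E) (e : E) :
    indicatorExp S e = if e ∈ S then 1 else 0 := by
  simp [indicatorExp, Finsupp.finsetSum_apply, Finsupp.single_apply]

theorem indicatorExp_injective : Function.Injective (indicatorExp (E := E)) := by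
  intro S T h
  ext e
  have := DFunLike.congr_fun h e
  simp only [indicatorExp_apply] at this
  split_ifs at this <;> simp_all

variable [Fintype E]

theorem indicatorExp_compl_erase {T : Finset E} {e : E} (he : e ∈ T) :
    indicatorExp (T.erase e)ᶜ = indicatorExp Tᶜ + Finsupp.single e 1 := by
  rw [Finset.compl_erase, indicatorExp, Finset.sum_insert (by simpa using he), add_comm]
  rfl

/-- A mass term `x_e ∏_{f ∉ T} x_f` is squarefree only if `e ∈ T`; this is the only way mass terms
and two-forest terms can collide. -/
theorem eq_erase_of_indicatorExp_eq {T F : Finset E} {e : E}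
    (h : indicatorExp Tᶜ + Finsupp.single e 1 = indicatorExp Fᶜ) : e ∈ T ∧ F = T.erase e := by
  have he : e ∈ T := by
    have := DFunLike.congr_fun h e
    simp only [Finsupp.add_apply, indicatorExp_apply, Finsupp.single_eq_same,
      Finset.mem_compl] at this
    split_ifs at this <;> simp_all
  refine ⟨he, compl_injective (indicatorExp_injective ?_)⟩
  rw [indicatorExp_compl_erase he, h]

end Exponents

/-! ### The support of `𝓕` for generic kinematics. -/

section Support

variable {V E : Type*} [Fintype V]

/-- Genericity of the kinematics relative to a set `X` of marked vertices: vertex sets that do not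
separate `X` have vanishing squared momentum, and the squared momentum of those that do is not a
sum of squared masses. -/
structure GenericFor (G : FeynmanGraph V E) (X : Set V) : Prop where
  momentumSq_eq_zero : ∀ A : Finset V, (∀ u ∈ X, ∀ v ∈ X, u ∈ A → v ∈ A) → G.momentumSq A = 0
  momentumSq_ne : ∀ A : Finset V, ∀ u ∈ X, ∀ v ∈ X, u ∈ A → v ∉ A →
    ∀ T : Finset E, T.Nonempty → G.momentumSq A ≠ ∑ e ∈ T, G.mass e ^ 2

/-- Only the external vertices of a set contribute to its squared momentum. A set that does not
separate them contains all or none, and momentum conservation gives zero. -/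
theorem Generic.genericFor {G : FeynmanGraph V E} (hG : G.Generic) :
    G.GenericFor G.externalVertices := by
  classical
  have hP : ∀ u v, G.P u v ≠ 0 → u ∈ G.externalVertices ∧ v ∈ G.externalVertices := by
    intro u v h
    simp only [externalVertices, Finset.mem_filter, Finset.mem_univ, true_and]
    exact ⟨⟨v, by rwa [G.symm]⟩, ⟨u, h⟩⟩
  have hinter : ∀ A, G.momentumSq A = G.momentumSq (A ∩ G.externalVertices) := by
    intro A
    unfold momentumSq
    refine (Finset.sum_subset_zero_on_sdiff Finset.inter_subset_left ?_ ?_).symm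
    · intro u hu
      refine Finset.sum_eq_zero fun v _ => ?_
      by_contra h
      have := (hP u v h).1
      simp_all
    · intro u _
      refine Finset.sum_subset_zero_on_sdiff Finset.inter_subset_left ?_ fun _ _ => rfl
      intro v hv
      by_contra h
      have := (hP u v h).2
      simp_all
  constructor
  · intro A hA
    rw [hinter]
    by_cases h : ∃ u ∈ G.externalVertices, u ∈ A
    · obtain ⟨u, hu, huA⟩ := h
      have : A ∩ G.externalVertices = Finset.univ ∩ G.externalVertices := by
        ext v
        simpa using fun hv => hA u hu v hv huA
      rw [this, ← hinter]
      exact Finset.sum_eq_zero fun u _ => G.sum_eq_zero u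
    · have : A ∩ G.externalVertices = ∅ := by
        ext v
        simpa using fun hv hvX => h ⟨v, hvX, hv⟩
      rw [this]
      simp [momentumSq]
  · intro A u hu v hv huA hvA T hT
    rw [hinter]
    refine hG _ ⟨u, Finset.mem_inter.2 ⟨huA, hu⟩⟩ ?_ T hT
    refine Finset.ssubset_iff_subset_ne.2 ⟨Finset.inter_subset_right, fun h => hvA ?_⟩
    exact (Finset.mem_inter.1 (h.symm ▸ Finset.mem_coe.1 hv : v ∈ A ∩ G.externalVertices)).1

variable [Fintype E] [DecidableEq E]

open Classical in
theorem coeff_symanzikF (G : FeynmanGraph V E) (k : E →₀ ℕ) :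
    G.symanzikF.coeff k =
      (∑ e, ∑ T : Finset E with G.IsSpanningForest 1 T,
        if indicatorExp Tᶜ + Finsupp.single e 1 = k then G.mass e ^ 2 else 0) -
      ∑ F : Finset E with G.IsSpanningForest 2 F,
        if indicatorExp Fᶜ = k then G.transferSq F else 0 := by
  unfold symanzikF symanzikU
  simp only [prod_X_eq_monomial, Finset.sum_mul_sum]
  simp only [ MvPolynomial.C_mul_monomial, MvPolynomial.X,
    MvPolynomial.monomial_mul, MvPolynomial.coeff_add, MvPolynomial.coeff_neg,
    MvPolynomial.coeff_sum, MvPolynomial.coeff_monomial, mul_one, one_mul]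
  rw [Finset.sum_comm]
  ring

/-- `X` lies in a single component of `(V, γ)`. -/
def Joins (G : FeynmanGraph V E) (X : Set V) (γ : Finset E) : Prop :=
  ∀ u ∈ X, ∀ v ∈ X, G.comp γ u = G.comp γ v

/-- The exponent vectors of the monomials of the second Symanzik polynomial for generic
kinematics. -/
def symanzikExponents (G : FeynmanGraph V E) (X : Set V) : Set (E →₀ ℕ) :=
  {k | ∃ T e, G.IsSpanningForest 1 T ∧ G.mass e ≠ 0 ∧ indicatorExp Tᶜ + Finsupp.single e 1 = k} ∪
    {k | ∃ F, G.IsSpanningForest 2 F ∧ ¬ G.Joins X F ∧ indicatorExp Fᶜ = k}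

omit [Fintype E] in
theorem transferSq_eq_zero {G : FeynmanGraph V E} {X : Set V} (hX : G.GenericFor X) {F : Finset E}
    (hF : G.IsSpanningForest 2 F) (hJ : G.Joins X F) : G.transferSq F = 0 := by
  classical
  obtain ⟨c⟩ : Nonempty (G.Comp F) := Fintype.card_pos_iff.1 (by
    have := hF.2; unfold numComp at this; omega)
  rw [G.transferSq_eq F hF.2 c]
  refine hX.momentumSq_eq_zero _ fun u hu v hv h => ?_
  simp only [compVerts, Finset.mem_filter, Finset.mem_univ, true_and] at h ⊢
  rw [← h, hJ u hu v hv]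

omit [Fintype E] in
theorem transferSq_ne {G : FeynmanGraph V E} {X : Set V} (hX : G.GenericFor X) {F : Finset E}
    (hF : G.IsSpanningForest 2 F) (hJ : ¬ G.Joins X F) {T : Finset E} (hT : T.Nonempty) :
    G.transferSq F ≠ ∑ e ∈ T, G.mass e ^ 2 := by
  classical
  unfold Joins at hJ
  push Not at hJ
  obtain ⟨u, hu, v, hv, huv⟩ := hJ
  rw [G.transferSq_eq F hF.2 (G.comp F u)]
  refine hX.momentumSq_ne _ u hu v hv ?_ ?_ T hT
  · simp [compVerts]
  · simpa [compVerts] using fun h => huv h.symm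

open Classical in
theorem coeff_indicatorExp_compl (G : FeynmanGraph V E) {F : Finset E}
    (hF : G.IsSpanningForest 2 F) :
    G.symanzikF.coeff (indicatorExp Fᶜ) =
      (∑ e with e ∉ F ∧ G.IsSpanningForest 1 (insert e F), G.mass e ^ 2) - G.transferSq F := by
  rw [coeff_symanzikF, Finset.sum_filter (fun e => e ∉ F ∧ G.IsSpanningForest 1 (insert e F))]
  congr 1
  · refine Finset.sum_congr rfl fun e _ => ?_
    split_ifs with h
    · rw [Finset.sum_eq_single_of_mem (insert e F) (by simpa using h.2), if_pos]
      · rw [← indicatorExp_compl_erase (Finset.mem_insert_self e F), Finset.erase_insert h.1]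
      · intro T _ hne
        refine if_neg fun hT => hne ?_
        obtain ⟨he, rfl⟩ := eq_erase_of_indicatorExp_eq hT
        exact (Finset.insert_erase he).symm
    · refine Finset.sum_eq_zero fun T hT => if_neg fun hT' => h ?_
      obtain ⟨he, rfl⟩ := eq_erase_of_indicatorExp_eq hT'
      rw [Finset.insert_erase he]
      exact ⟨Finset.notMem_erase e T, (Finset.mem_filter.1 hT).2⟩
  · rw [Finset.sum_eq_single_of_mem F (by simpa using hF), if_pos rfl]
    intro F' _ hne
    exact if_neg fun h => hne (compl_injective (indicatorExp_injective h))

/-- Away from two-forest monomials only squared masses contribute, so nothing cancels. At a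
separating two-forest, connectedness makes the set of completing edges non-empty, as genericity
requires; this covers the case that all of them are massless. -/
theorem coeff_symanzikF_ne_zero_iff {G : FeynmanGraph V E} (hG : G.Connected) {X : Set V}
    (hX : G.GenericFor X) (k : E →₀ ℕ) :
    G.symanzikF.coeff k ≠ 0 ↔ k ∈ G.symanzikExponents X := by
  classical
  by_cases hk : ∃ F, G.IsSpanningForest 2 F ∧ indicatorExp Fᶜ = k
  · obtain ⟨F, hF, rfl⟩ := hk
    rw [coeff_indicatorExp_compl G hF]
    by_cases hJ : G.Joins X F
    · rw [transferSq_eq_zero hX hF hJ, sub_zero, ne_eq,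
        Finset.sum_eq_zero_iff_of_nonneg fun _ _ => sq_nonneg _]
      constructor
      · intro h
        push Not at h
        obtain ⟨e, he, hm⟩ := h
        simp only [Finset.mem_filter, Finset.mem_univ, true_and] at he
        refine Or.inl ⟨insert e F, e, he.2, by simpa using hm, ?_⟩
        rw [← indicatorExp_compl_erase (Finset.mem_insert_self e F), Finset.erase_insert he.1]
      · rintro (⟨T, e, hT, hm, h⟩ | ⟨F', -, hJ', h⟩) h0
        · obtain ⟨he, rfl⟩ := eq_erase_of_indicatorExp_eq h
          refine hm (pow_eq_zero_iff two_ne_zero |>.1 (h0 e ?_))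
          simpa [Finset.insert_erase he] using hT
        · exact hJ' (compl_injective (indicatorExp_injective h) ▸ hJ)
    · obtain ⟨e, he, hT⟩ := hF.exists_insert G hG
      exact iff_of_true
        (sub_ne_zero.2 (transferSq_ne hX hF hJ ⟨e, by simpa using ⟨he, hT⟩⟩).symm)
        (Or.inr ⟨F, hF, hJ, rfl⟩)
  · push Not at hk
    rw [coeff_symanzikF, Finset.sum_eq_zero (s := Finset.univ.filter (G.IsSpanningForest 2))
      fun F hF => if_neg (hk F (by simpa using hF)), sub_zero, ne_eq,
      Finset.sum_eq_zero_iff_of_nonneg fun _ _ => Finset.sum_nonneg fun _ _ => by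
        split_ifs <;> positivity]
    constructor
    · intro h
      push Not at h
      obtain ⟨e, -, h⟩ := h
      obtain ⟨T, hT, h⟩ := Finset.exists_ne_zero_of_sum_ne_zero h
      rw [ite_ne_right_iff] at h
      exact Or.inl ⟨T, e, by simpa using hT, by simpa using h.2, h.1⟩
    · rintro (⟨T, e, hT, hm, h⟩ | ⟨F, hF, -, h⟩) h0
      · have := (Finset.sum_eq_zero_iff_of_nonneg fun _ _ => by split_ifs <;> positivity).1
          (h0 e (Finset.mem_univ e)) T (by simpa using hT)
        rw [if_pos h] at this
        exact hm (pow_eq_zero_iff two_ne_zero |>.1 this)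
      · exact hk F hF h

/-- `γ` contains all massive edges and joins the marked vertices. -/
def Spans (G : FeynmanGraph V E) (X : Set V) (γ : Finset E) : Prop :=
  (∀ e, G.mass e ≠ 0 → e ∈ γ) ∧ G.Joins X γ

/-- Given a spanning tree, any massive edge yields an exponent, and so does cutting the tree between
two distinct marked vertices. -/
theorem symanzikF_eq_zero_iff {G : FeynmanGraph V E} (hG : G.Connected) {X : Set V}
    (hX : G.GenericFor X) : G.symanzikF = 0 ↔ G.Spans X ∅ := by
  have h1 : G.symanzikF = 0 ↔ ∀ k, k ∉ G.symanzikExponents X := by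
    simp only [MvPolynomial.ext_iff, MvPolynomial.coeff_zero,
      ← coeff_symanzikF_ne_zero_iff hG hX, not_not]
  rw [h1]
  constructor
  · intro h
    obtain ⟨T, hT⟩ := G.exists_isSpanningForest_one hG
    refine ⟨fun e he => absurd (Or.inl ⟨T, e, hT, he, rfl⟩) (h _), fun u hu v hv => ?_⟩
    by_cases huv : u = v
    · rw [huv]
    · obtain ⟨e, he, hne⟩ := G.exists_erase_separating hT.1 huv
        (G.comp_eq_of_numComp_eq_one hT.2 u v)
      exact absurd (Or.inr ⟨_, hT.erase G he, fun hJ => hne (hJ u hu v hv), rfl⟩) (h _)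
  · rintro ⟨hm, hJ⟩ k (⟨T, e, hT, he, -⟩ | ⟨F, hF, hJF, -⟩)
    · exact absurd (hm e he) (Finset.notMem_empty e)
    · exact hJF fun u hu v hv => G.comp_mono (Finset.empty_subset F) (hJ u hu v hv)

end Support

/-! ### Cographs and the explicit form of `z_𝓕`. -/

section Contraction

variable {V E : Type*} [Fintype V]

theorem momentumSq_contract (G : FeynmanGraph V E) (γ : Finset E) (A : Finset (G.Comp γ))
    (B : Finset V) (hB : ∀ v, v ∈ B ↔ G.comp γ v ∈ A) :
    (G.contract γ).momentumSq A = G.momentumSq B := by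
  classical
  have key : ∀ f : V → ℝ, ∑ c ∈ A, ∑ v ∈ G.compVerts γ c, f v = ∑ v ∈ B, f v := by
    intro f
    rw [← Finset.sum_fiberwise_of_maps_to (g := G.comp γ) (t := A) fun v hv => (hB v).1 hv]
    refine Finset.sum_congr rfl fun c hc => Finset.sum_congr ?_ fun _ _ => rfl
    ext v
    simp only [compVerts, Finset.mem_filter, Finset.mem_univ, true_and, hB]
    exact ⟨fun h => ⟨h ▸ hc, h⟩, fun h => h.2⟩
  unfold momentumSq contract
  dsimp only
  rw [← key]
  refine Finset.sum_congr rfl fun c _ => ?_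
  rw [Finset.sum_comm]
  exact Finset.sum_congr rfl fun u _ => key _

/-- Vertex sets of the cograph pull back to unions of components with the same squared momentum.
Marking the image of `X` avoids having to identify the external vertices of the cograph. -/
theorem GenericFor.contract {G : FeynmanGraph V E} {X : Set V} (hX : G.GenericFor X)
    (γ : Finset E) : (G.contract γ).GenericFor (G.comp γ '' X) := by
  classical
  have hB : ∀ A : Finset (G.Comp γ), ∀ v,
      v ∈ Finset.univ.filter (fun v => G.comp γ v ∈ A) ↔ G.comp γ v ∈ A := by simp
  constructor
  · intro A hA
    rw [G.momentumSq_contract γ A _ (hB A)]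
    refine hX.momentumSq_eq_zero _ fun u hu v hv h => ?_
    rw [hB] at h ⊢
    exact hA _ ⟨u, hu, rfl⟩ _ ⟨v, hv, rfl⟩ h
  · rintro A _ ⟨u, hu, rfl⟩ _ ⟨v, hv, rfl⟩ huA hvA T hT
    rw [G.momentumSq_contract γ A _ (hB A)]
    have := hX.momentumSq_ne _ u hu v hv ((hB A u).2 huA) (fun h => hvA ((hB A v).1 h))
      (T.map (Function.Embedding.subtype _)) (hT.map)
    rwa [Finset.sum_map] at this

variable [Fintype E] [DecidableEq E]

theorem Connected.contract {G : FeynmanGraph V E} (hG : G.Connected) (γ : Finset E) :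
    (G.contract γ).Connected := by
  have hne : Nonempty V := by
    obtain ⟨c⟩ : Nonempty (G.Comp Finset.univ) := Fintype.card_pos_iff.1 (by
      have := hG; unfold Connected numComp at this; omega)
    exact ⟨(G.comp_surjective _ c).choose⟩
  obtain ⟨v⟩ := hne
  refine Fintype.card_eq_one_iff.2 ⟨(G.contract γ).comp _ (G.comp γ v), fun d => ?_⟩
  obtain ⟨c, rfl⟩ := (G.contract γ).comp_surjective _ d
  obtain ⟨u, rfl⟩ := G.comp_surjective _ c
  refine G.eq_of_comp_eq (γ := Finset.univ)
    (fun w => (G.contract γ).comp Finset.univ (G.comp γ w)) (fun e _ a b hab => ?_)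
    (G.comp_eq_of_numComp_eq_one hG u v)
  by_cases he : e ∈ γ
  · simp only [G.comp_ends he hab]
  · refine (G.contract γ).comp_ends (Finset.mem_univ ⟨e, he⟩) ?_
    simp [FeynmanGraph.contract, hab]

theorem massMomentumSpanning_iff {G : FeynmanGraph V E} (hG : G.Connected) (hgen : G.Generic)
    (γ : Finset E) : G.MassMomentumSpanning γ ↔ G.Spans G.externalVertices γ := by
  unfold MassMomentumSpanning
  rw [symanzikF_eq_zero_iff (hG.contract γ) (hgen.genericFor.contract γ)]
  refine and_congr ⟨fun h e he => ?_, fun h e he => absurd (h e he) e.2⟩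
    ⟨fun h u hu v hv => ?_, ?_⟩
  · by_contra hγ
    exact Finset.notMem_empty _ (h ⟨e, hγ⟩ he)
  · exact (G.contract γ).comp_empty (h _ ⟨u, hu, rfl⟩ _ ⟨v, hv, rfl⟩)
  · rintro h _ ⟨u, hu, rfl⟩ _ ⟨v, hv, rfl⟩
    rw [h u hu v hv]

open Classical in
theorem zF_eq {G : FeynmanGraph V E} (hG : G.Connected) (hgen : G.Generic) (γ : Finset E) :
    G.zF γ = G.loopNumber γ + if G.Spans G.externalVertices γ then 1 else 0 := by
  unfold zF
  simp only [massMomentumSpanning_iff hG hgen]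
  split_ifs <;> simp

end Contraction
end FeynmanGraph

/-! ### The greedy algorithm on base polytopes. -/

section Greedy

variable {E : Type*} [DecidableEq E]

/-- The vectors produced on `S` by the greedy algorithm for the set function `z`. -/
inductive IsGreedy (z : Finset E → ℝ) : Finset E → (E → ℝ) → Prop
  | empty : IsGreedy z ∅ 0
  | insert {S : Finset E} {g : E → ℝ} (e : E) (he : e ∉ S) (hg : IsGreedy z S g) :
      IsGreedy z (insert e S) (Function.update g e (z (insert e S) - z S))

variable [Fintype E]

/-- For every linear functional `c`, some greedy vector bounds `c` from below on the base
polytope. -/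
theorem exists_isGreedy_le (z : Finset E → ℝ) (h0 : z ∅ = 0) (c : E → ℝ) :
    ∃ g, IsGreedy z Finset.univ g ∧ ∀ a ∈ basePolytope z, ∑ e, c e * g e ≤ ∑ e, c e * a e := by
  -- Edges enter in order of decreasing `c`. The shift `t` keeps all weights on `S` non-negative, so
  -- lower bounds on partial sums suffice.
  have key : ∀ n ≤ Fintype.card E, ∃ S : Finset E, ∃ g, S.card = n ∧ IsGreedy z S g ∧
      (∀ e ∈ S, ∀ f ∉ S, c f ≤ c e) ∧ ∑ e ∈ S, g e = z S ∧
      ∀ a : E → ℝ, (∀ γ, z γ ≤ ∑ e ∈ γ, a e) → ∀ t, (∀ e ∈ S, t ≤ c e) →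
        ∑ e ∈ S, (c e - t) * g e ≤ ∑ e ∈ S, (c e - t) * a e := by
    intro n
    induction n with
    | zero => exact fun _ => ⟨∅, 0, rfl, .empty, by simp, by simp [h0], by simp⟩
    | succ n ih =>
      intro hn
      obtain ⟨S, g, hS, hg, hc, hsum, hle⟩ := ih (by omega)
      have hne : Sᶜ.Nonempty := by
        rw [← Finset.card_pos, Finset.card_compl]
        omega
      obtain ⟨f, hf, hmax⟩ := Finset.exists_max_image Sᶜ c hne
      rw [Finset.mem_compl] at hf
      have hupd : ∀ w : E → ℝ, ∑ e ∈ S, w e * Function.update g f (z (insert f S) - z S) e =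
          ∑ e ∈ S, w e * g e := fun w => Finset.sum_congr rfl fun e he => by
        rw [Function.update_of_ne (ne_of_mem_of_not_mem he hf)]
      have hsum' : ∑ e ∈ insert f S, Function.update g f (z (insert f S) - z S) e =
          z (insert f S) := by
        have := hupd 1
        simp only [Pi.one_apply, one_mul] at this
        rw [Finset.sum_insert hf, this, Function.update_self, hsum]
        ring
      refine ⟨insert f S, _, by rw [Finset.card_insert_of_notMem hf, hS], hg.insert f hf, ?_,
        hsum', ?_⟩
      · intro e he d hd
        rw [Finset.mem_insert, not_or] at hd
        rcases Finset.mem_insert.1 he with rfl | he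
        · exact hmax d (Finset.mem_compl.2 hd.2)
        · exact hc e he d hd.2
      · intro a ha t ht
        -- Abel summation: lowering the weights to `c e - c f` leaves the induction hypothesis on
        -- `S` and a non-negative multiple of a total on which `g` is tight.
        have split : ∀ b : E → ℝ, ∑ e ∈ insert f S, (c e - t) * b e =
            ∑ e ∈ S, (c e - c f) * b e + (c f - t) * ∑ e ∈ insert f S, b e := by
          intro b
          rw [Finset.sum_insert hf, Finset.sum_insert hf, mul_add, Finset.mul_sum,
            add_left_comm, ← Finset.sum_add_distrib]
          congr 1
          exact Finset.sum_congr rfl fun e _ => by ring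
        rw [split, split, hsum', hupd]
        refine add_le_add (hle a ha (c f) fun e he => hc e he f hf) ?_
        exact mul_le_mul_of_nonneg_left (ha _)
          (sub_nonneg.2 (ht f (Finset.mem_insert_self f S)))
  obtain ⟨S, g, hS, hg, -, hsum, hle⟩ := key _ le_rfl
  obtain rfl := (Finset.card_eq_iff_eq_univ S).1 hS
  refine ⟨g, hg, fun a ha => ?_⟩
  -- Any lower bound works: `g` and `a` have the same total, so `t` cancels.
  obtain ⟨t, ht⟩ : ∃ t, ∀ e, t ≤ c e := by
    obtain ⟨t, ht⟩ := (Set.finite_range c).bddBelow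
    exact ⟨t, fun e => ht ⟨e, rfl⟩⟩
  have h1 := hle a (fun γ => ?_) t fun e _ => ht e
  · simp only [sub_mul, Finset.sum_sub_distrib, ← Finset.mul_sum, hsum, ha.1] at h1
    linarith
  · rcases (Finset.subset_univ γ).eq_or_ssubset with rfl | h
    · exact ha.1.ge
    · exact ha.2 γ h

omit [DecidableEq E] in
theorem convex_basePolytope (z : Finset E → ℝ) : Convex ℝ (basePolytope z) := by
  have hsum : ∀ (γ : Finset E) (s t : ℝ) (a b : E → ℝ),
      ∑ e ∈ γ, (s • a + t • b) e = s * ∑ e ∈ γ, a e + t * ∑ e ∈ γ, b e := by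
    intro γ s t a b
    simp [Finset.sum_add_distrib, Finset.mul_sum]
  rintro a ⟨ha, ha'⟩ b ⟨hb, hb'⟩ s t hs ht hst
  refine ⟨by rw [hsum, ha, hb, ← add_mul, hst, one_mul], fun γ hγ => ?_⟩
  rw [hsum]
  calc z γ = s * z γ + t * z γ := by rw [← add_mul, hst, one_mul]
    _ ≤ _ := add_le_add (mul_le_mul_of_nonneg_left (ha' γ hγ) hs)
      (mul_le_mul_of_nonneg_left (hb' γ hγ) ht)

/-- A finite subset of the base polytope that contains all greedy vectors spans it. -/
theorem convexHull_eq_basePolytope {z : Finset E → ℝ} (h0 : z ∅ = 0) {K : Set (E → ℝ)}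
    (hfin : K.Finite) (hK : K ⊆ basePolytope z) (hg : ∀ g, IsGreedy z Finset.univ g → g ∈ K) :
    convexHull ℝ K = basePolytope z := by
  refine (convexHull_min hK (convex_basePolytope z)).antisymm fun a ha => ?_
  by_contra hna
  obtain ⟨f, r, hf, hr⟩ := geometric_hahn_banach_closed_point (convex_convexHull ℝ K)
    (hfin.isCompact_convexHull ℝ).isClosed hna
  -- The sign is reversed because greedy vectors minimise, whereas `f` is larger at `a` than on the
  -- hull.
  obtain ⟨g, hgr, hle⟩ := exists_isGreedy_le z h0 (fun e => -f (Pi.single e 1))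
  have hfx : ∀ x : E → ℝ, ∑ e, -f (Pi.single e 1) * x e = -f x := by
    intro x
    conv_rhs => rw [← Finset.univ_sum_single x, map_sum, ← Finset.sum_neg_distrib]
    refine Finset.sum_congr rfl fun e _ => ?_
    have : (Pi.single e (x e) : E → ℝ) = x e • Pi.single e 1 := by
      rw [← Pi.single_smul, smul_eq_mul, mul_one]
    rw [this, map_smul, smul_eq_mul]
    ring
  have h1 := hle a ha
  rw [hfx, hfx] at h1
  have h2 := hf g (subset_convexHull ℝ K (hg g hgr))
  linarith

end Greedy

/-! ### Supermodularity and greedy vectors of `z_𝓕`. -/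

namespace FeynmanGraph

variable {V E : Type*} [Fintype V] [DecidableEq E] (G : FeynmanGraph V E)

omit [DecidableEq E] in
theorem Joins.mono {G : FeynmanGraph V E} {X : Set V} {γ δ : Finset E} (h : G.Joins X γ)
    (hγδ : γ ⊆ δ) : G.Joins X δ :=
  fun u hu v hv => G.comp_mono hγδ (h u hu v hv)

omit [DecidableEq E] in
theorem Spans.mono {G : FeynmanGraph V E} {X : Set V} {γ δ : Finset E} (h : G.Spans X γ)
    (hγδ : γ ⊆ δ) : G.Spans X δ :=
  ⟨fun e he => hγδ (h.1 e he), h.2.mono hγδ⟩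

/-- The function `z_𝓕` with the mass-momentum spanning subgraphs described explicitly. -/
noncomputable def spanningLoopNumber (X : Set V) (γ : Finset E) : ℤ :=
  open Classical in G.loopNumber γ + if G.Spans X γ then 1 else 0

/-- The indicators can do harm only if `γ` and `δ` span but `γ ∩ δ` does not. As `γ ∩ δ` then still
contains the massive edges, it separates some marked pair, whose joining indicator agrees with the
spanning one on all four sets. -/
theorem spanningLoopNumber_supermodular (X : Set V) (γ δ : Finset E) :
    G.spanningLoopNumber X γ + G.spanningLoopNumber X δ ≤
      G.spanningLoopNumber X (γ ∪ δ) + G.spanningLoopNumber X (γ ∩ δ) := by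
  classical
  have h := G.loopNumber_supermodular γ δ
  unfold spanningLoopNumber
  have hγ : G.Spans X γ → G.Spans X (γ ∪ δ) := fun h => h.mono Finset.subset_union_left
  have hδ : G.Spans X δ → G.Spans X (γ ∪ δ) := fun h => h.mono Finset.subset_union_right
  by_cases hb : G.Spans X γ ∧ G.Spans X δ ∧ ¬ G.Spans X (γ ∩ δ)
  · obtain ⟨h1, h2, h3⟩ := hb
    have : ¬ G.Joins X (γ ∩ δ) := fun hJ =>
      h3 ⟨fun e he => Finset.mem_inter.2 ⟨h1.1 e he, h2.1 e he⟩, hJ⟩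
    unfold Joins at this
    push Not at this
    obtain ⟨u, hu, v, hv, huv⟩ := this
    have := G.loopNumber_add_supermodular u v γ δ
    rw [if_pos (h1.2 u hu v hv), if_pos (h2.2 u hu v hv), if_pos ((hγ h1).2 u hu v hv),
      if_neg huv] at this
    rw [if_pos h1, if_pos h2, if_pos (hγ h1), if_neg h3]
    exact this
  · split_ifs <;> first | omega | tauto

/-- The shape of the greedy vectors of `spanningLoopNumber`. -/
theorem IsGreedy.exists_forest {X : Set V} (h0 : ¬ G.Spans X ∅) {S : Finset E} {g : E → ℝ}
    (hg : IsGreedy (fun γ => (G.spanningLoopNumber X γ : ℝ)) S g) :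
    ∃ T, G.IsMaximalForest S T ∧
      (¬ G.Spans X S → g = fun e => if e ∈ S \ T then 1 else 0) ∧
      (G.Spans X S → ∃ e, (G.mass e ≠ 0 ∨ e ∈ T ∧ ¬ G.Joins X (T.erase e)) ∧
        g = (fun f => if f ∈ S \ T then 1 else 0) + Pi.single e 1) := by
  classical
  induction hg with
  | empty => exact ⟨∅, G.isMaximalForest_empty, fun _ => by ext; simp, fun h => absurd h h0⟩
  | @insert S g e he hg ih =>
    obtain ⟨T, hT, h1, h2⟩ := ih
    obtain ⟨a, b, hab⟩ := G.exists_ends e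
    have heT : e ∉ T := fun h => he (hT.subset h)
    -- the first summand of the increment is the indicator of `e` lying outside the forest
    obtain ⟨T', hT', hTT', hloop, hTe, hjoin⟩ : ∃ T', G.IsMaximalForest (insert e S) T' ∧ T ⊆ T' ∧
        (G.loopNumber (insert e S) - G.loopNumber S = if e ∈ T' then 0 else 1) ∧
        T'.erase e = T ∧ (e ∉ T' → G.Joins X (insert e S) → G.Joins X S) := by
      by_cases hS : G.comp S a = G.comp S b
      · refine ⟨T, hT.insert_of_eq G hab hS, subset_rfl, ?_, Finset.erase_eq_of_notMem heT,
          fun _ hJ u hu v hv => (G.comp_insert_of_eq hab hS u v).1 (hJ u hu v hv)⟩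
        rw [G.loopNumber_insert he hab, if_pos hS, if_neg heT]
        ring
      · refine ⟨insert e T, hT.insert_of_ne G hab hS, Finset.subset_insert e T, ?_,
          Finset.erase_insert heT, fun h => absurd (Finset.mem_insert_self e T) h⟩
        rw [G.loopNumber_insert he hab, if_neg hS, if_pos (Finset.mem_insert_self e T)]
        ring
    have hmem : ∀ f, f ≠ e → (f ∈ insert e S \ T' ↔ f ∈ S \ T) := by
      intro f hf
      rw [← hTe]
      simp [hf]
    have heT' : e ∈ insert e S \ T' ↔ e ∉ T' := by simp
    have hloopR : (G.loopNumber (insert e S) : ℝ) - G.loopNumber S = if e ∈ T' then 0 else 1 := by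
      exact_mod_cast hloop
    refine ⟨T', hT', fun hs => ?_, fun hs => ?_⟩
    · have hS : ¬ G.Spans X S := fun h => hs (h.mono (Finset.subset_insert e S))
      rw [h1 hS]
      ext f
      by_cases hf : f = e
      · subst hf
        simp only [Function.update_self, spanningLoopNumber, if_neg hs, if_neg hS, heT', add_zero,
          hloopR]
        split_ifs <;> rfl
      · simp only [Function.update_of_ne hf, hmem f hf]
    -- If `S` already spans, the extra unit stays at its old edge `d`, which still cuts the larger
    -- forest between marked vertices if it did before.
    · by_cases hS : G.Spans X S
      · obtain ⟨d, hd, hgd⟩ := h2 hS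
        refine ⟨d, hd.imp_right ?_, ?_⟩
        · rintro ⟨hdT, hJ⟩
          refine ⟨hTT' hdT, ?_⟩
          unfold Joins at hJ ⊢
          push Not at hJ ⊢
          obtain ⟨u, hu, v, hv, huv⟩ := hJ
          exact ⟨u, hu, v, hv, G.comp_erase_ne hT'.isForest hTT' hdT
            ((hT.comp_iff u v).2 (hS.2 u hu v hv)) huv⟩
        · have hde : e ≠ d := fun h => he (h ▸ hd.elim (hS.1 d) fun h => hT.subset h.1)
          rw [hgd]
          ext f
          by_cases hf : f = e
          · subst hf
            simp only [Function.update_self, spanningLoopNumber, if_pos hs, if_pos hS, heT',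
              Pi.add_apply, Pi.single_eq_of_ne hde, add_zero]
            push_cast
            rw [add_sub_add_right_eq_sub, hloopR]
            split_ifs <;> rfl
          · simp only [Function.update_of_ne hf, Pi.add_apply, hmem f hf]
      -- Here `e` itself completes the spanning condition and receives the extra unit. If `e` is
      -- massless, `S` fails to join `X`, so `e` enters the forest and its removal gives back `T`.
      · refine ⟨e, ?_, ?_⟩
        · by_cases hm : G.mass e = 0
          · have hJ : ¬ G.Joins X S := fun hJ => hS ⟨fun f hf =>
              (Finset.mem_insert.1 (hs.1 f hf)).resolve_left fun h => hf (h ▸ hm), hJ⟩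
            refine Or.inr ⟨by_contra fun h => hJ (hjoin h hs.2), fun h => hJ ?_⟩
            rw [hTe] at h
            exact fun u hu v hv => (hT.comp_iff u v).1 (h u hu v hv)
          · exact Or.inl hm
        · rw [h1 hS]
          ext f
          by_cases hf : f = e
          · subst hf
            simp only [Function.update_self, spanningLoopNumber, if_pos hs, if_neg hS, heT',
              add_zero, Pi.add_apply, Pi.single_eq_same]
            push_cast
            rw [add_sub_right_comm, hloopR]
            split_ifs <;> rfl
          · simp only [Function.update_of_ne hf, Pi.add_apply, Pi.single_eq_of_ne hf, hmem f hf,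
              add_zero]

end FeynmanGraph

/-! ### The Newton polytope as a base polytope. -/

namespace FeynmanGraph

variable {V E : Type*} [Fintype V] [Fintype E] [DecidableEq E]

theorem sum_indicatorExp_compl (γ T : Finset E) :
    ∑ e ∈ γ, (indicatorExp Tᶜ e : ℝ) = ((γ \ T).card : ℝ) := by
  simp only [indicatorExp_apply, Nat.cast_ite, Nat.cast_one, Nat.cast_zero, Finset.sum_boole,
    Finset.mem_compl, Finset.sdiff_eq_filter]

theorem Connected.loopNumber_univ {G : FeynmanGraph V E} (hG : G.Connected) {k : ℕ} {T : Finset E}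
    (hT : G.IsSpanningForest k T) :
    ((Finset.univ \ T).card : ℤ) = G.loopNumber Finset.univ + k - 1 := by
  have h1 := G.card_add_numComp hT.1
  have h2 := Finset.card_sdiff_add_card_eq_card (Finset.subset_univ T)
  have h3 : G.numComp Finset.univ = 1 := hG
  have h4 := hT.2
  unfold loopNumber
  omega

omit [DecidableEq E] in
theorem Connected.spans_univ {G : FeynmanGraph V E} (hG : G.Connected) (X : Set V) :
    G.Spans X Finset.univ :=
  ⟨fun e _ => Finset.mem_univ e, fun u _ v _ => G.comp_eq_of_numComp_eq_one hG u v⟩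

/-- On a spanning `γ` one unit more than the loop number is needed: for a tree term it comes from
the massive edge, which lies in `γ`; for a two-forest term, from a marked pair joined by `γ` but not
by `F`. -/
theorem symanzikExponents_subset {G : FeynmanGraph V E} (hG : G.Connected) (X : Set V) :
    (fun (k : E →₀ ℕ) (e : E) => (k e : ℝ)) '' G.symanzikExponents X ⊆
      basePolytope fun γ => (G.spanningLoopNumber X γ : ℝ) := by
  rintro _ ⟨k, ⟨T, e, hT, he, rfl⟩ | ⟨F, hF, hJ, rfl⟩, rfl⟩
  · have hsum : ∀ γ : Finset E, ∑ f ∈ γ, ((indicatorExp Tᶜ + Finsupp.single e 1 : E →₀ ℕ) f : ℝ) =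
        (((γ \ T).card + if e ∈ γ then 1 else 0 : ℤ) : ℝ) := by
      intro γ
      simp only [Finsupp.add_apply, Nat.cast_add, Finset.sum_add_distrib, sum_indicatorExp_compl]
      push_cast
      congr 1
      simp [Finsupp.single_apply]
    refine ⟨?_, fun γ _ => ?_⟩
    · rw [hsum]
      unfold spanningLoopNumber
      beta_reduce
      rw [if_pos (hG.spans_univ X), hG.loopNumber_univ hT]
      simp
    · rw [hsum]
      unfold spanningLoopNumber
      beta_reduce
      refine Int.cast_le.2 (add_le_add (G.loopNumber_le_card_sdiff hT.1 γ) ?_)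
      by_cases hγ : G.Spans X γ
      · rw [if_pos hγ, if_pos (hγ.1 e he)]
      · rw [if_neg hγ]
        split_ifs <;> simp
  · refine ⟨?_, fun γ _ => ?_⟩
    · rw [sum_indicatorExp_compl]
      unfold spanningLoopNumber
      beta_reduce
      rw [if_pos (hG.spans_univ X)]
      have := hG.loopNumber_univ hF
      have : ((Finset.univ \ F).card : ℤ) = G.loopNumber Finset.univ + 1 := by
        push_cast at this; omega
      exact_mod_cast this
    · rw [sum_indicatorExp_compl]
      unfold spanningLoopNumber
      beta_reduce
      rw [← Int.cast_natCast, Int.cast_le]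
      by_cases hγ : G.Spans X γ
      · rw [if_pos hγ]
        unfold Joins at hJ
        push Not at hJ
        obtain ⟨u, hu, v, hv, huv⟩ := hJ
        exact G.loopNumber_lt_card_sdiff hF.1 (hγ.2 u hu v hv) huv
      · rw [if_neg hγ, add_zero]
        exact G.loopNumber_le_card_sdiff hF.1 γ

theorem IsGreedy.mem_symanzikExponents {G : FeynmanGraph V E} (hG : G.Connected) {X : Set V}
    (h0 : ¬ G.Spans X ∅) {g : E → ℝ}
    (hg : IsGreedy (fun γ => (G.spanningLoopNumber X γ : ℝ)) Finset.univ g) :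
    g ∈ (fun (k : E →₀ ℕ) (e : E) => (k e : ℝ)) '' G.symanzikExponents X := by
  obtain ⟨T, hT, -, h⟩ := IsGreedy.exists_forest G h0 hg
  obtain ⟨e, he, rfl⟩ := h (hG.spans_univ X)
  refine ⟨indicatorExp Tᶜ + Finsupp.single e 1, ?_, ?_⟩
  · have hT' := hT.isSpanningForest G hG
    rcases he with he | ⟨heT, hJ⟩
    · exact Or.inl ⟨T, e, hT', he, rfl⟩
    · exact Or.inr ⟨_, hT'.erase G heT, hJ, indicatorExp_compl_erase heT⟩
  · ext f
    simp [indicatorExp_apply, Finsupp.single_apply, Pi.single_apply, eq_comm]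

theorem newtonPolytope_symanzikF {G : FeynmanGraph V E} (hG : G.Connected) {X : Set V}
    (hX : G.GenericFor X) :
    newtonPolytope G.symanzikF = basePolytope fun γ => (G.spanningLoopNumber X γ : ℝ) := by
  have hsupp : {k | G.symanzikF.coeff k ≠ 0} = G.symanzikExponents X :=
    Set.ext (coeff_symanzikF_ne_zero_iff hG hX)
  have hempty : (G.spanningLoopNumber X ∅ : ℝ) =
      open Classical in if G.Spans X ∅ then 1 else 0 := by
    rw [spanningLoopNumber, loopNumber_empty]
    split_ifs <;> simp
  -- If `∅` spans, then `𝓕 = 0`, and the base polytope is empty too because `z ∅ = 1` exceeds the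
  -- empty sum.
  by_cases h0 : G.Spans X ∅
  · rw [newtonPolytope, (symanzikF_eq_zero_iff hG hX).2 h0]
    simp only [MvPolynomial.coeff_zero, ne_eq, not_true_eq_false, Set.ofPred_false,
      Set.image_empty, convexHull_empty]
    rw [if_pos h0] at hempty
    refine (Set.eq_empty_of_forall_notMem fun a ha => ?_).symm
    -- Without edges, `∅` is the full edge set, and the contradiction comes from the equality
    -- constraint instead of an inequality.
    rcases (Finset.subset_univ (∅ : Finset E)).eq_or_ssubset with h | h
    · have := ha.1
      rw [← h] at this
      simp [hempty] at this
    · have := ha.2 ∅ h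
      simp only [hempty, Finset.sum_empty] at this
      linarith
  · rw [newtonPolytope, hsupp]
    refine convexHull_eq_basePolytope (by rw [hempty, if_neg h0]) ?_
      (symanzikExponents_subset hG X) fun g hg => IsGreedy.mem_symanzikExponents hG h0 hg
    rw [← hsupp]
    exact (G.symanzikF.support.finite_toSet.subset fun k hk =>
      MvPolynomial.mem_support_iff.2 hk).image _

end FeynmanGraph

theorem mainTheorem2 {V E : Type*} [Fintype V] [Fintype E] [DecidableEq E]
    (G : FeynmanGraph V E) (hconn : G.Connected) (hgen : G.Generic) :
    newtonPolytope G.symanzikF = basePolytope G.zF ∧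
      IsSupermodular G.zF ∧
      IsGeneralizedPermutahedron (newtonPolytope G.symanzikF) := by
  have hz : G.zF = fun γ => (G.spanningLoopNumber G.externalVertices γ : ℝ) := by
    ext γ
    rw [FeynmanGraph.zF_eq hconn hgen, FeynmanGraph.spanningLoopNumber]
    push_cast
    rfl
  have h1 : newtonPolytope G.symanzikF = basePolytope G.zF := by
    rw [hz, FeynmanGraph.newtonPolytope_symanzikF hconn hgen.genericFor]
  have h2 : IsSupermodular G.zF := by
    intro γ δ
    rw [hz]
    beta_reduce
    exact_mod_cast G.spanningLoopNumber_supermodular _ γ δ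
  exact ⟨h1, h2, G.zF, h2, h1⟩
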